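/- All graphs are finite and simple. For a graph $G$ with vertex set $V(G)$, let $\mathcal{S}(G)$ (respectively $\mathcal{H}(G)$) be the set of real symmetric (respectively complex Hermitian) matrices $A=(a_{ij})_{i,j\in V(G)}$ such that for all $i\neq j$, $a_{ij}\neq 0$ if and only if $ij$ is an edge of $G$; the diagonal entries are unrestricted. For a Hermitian matrix $A$ let $\mathrm{pin}(A)=(\pi(A),\nu(A))$, where $\pi(A)$ and $\nu(A)$ are the numbers of positive and of negative eigenvalues of $A$, counted with multiplicity. Put $\mathcal{I}(G)=\{\mathrm{pin}(A): A\in\mathcal{S}(G)\}$ and $\mathrm{h}\mathcal{I}(G)=\{\mathrm{pin}(A): A\in\mathcal{H}(G)\}$. Sums of subsets of $\mathbb{N}^2$ are elementwise sums, and $[Q]_n=\{(r,s)\in Q: r+s\le n\}$ for $Q\subseteq\mathbb{N}^2$. **Theorem.** Let $k\ge 2$, let $G_1,\dots,G_k$ be graphs, each on at least two vertices and each with a vertex labeled $v$, and let $G$ be their vertex sum at $v$, that is, the graph obtained from the disjoint union of $G_1,\dots,G_k$ by identifying the $k$ vertices labeled $v$. Let $n=\sum_{i=1}^k |V(G_i)|-(k-1)$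 be the number of vertices of $G$. Then $$\mathcal{I}(G)=\bigl[\mathcal{I}(G_1)+\cdots+\mathcal{I}(G_k)\bigr]_n\ \cup\ \bigl[\mathcal{I}(G_1-v)+\cdots+\mathcal{I}(G_k-v)+\{(1,1)\}\bigr]_n,$$ and $$\mathrm{h}\mathcal{I}(G)=\bigl[\mathrm{h}\mathcal{I}(G_1)+\cdots+\mathrm{h}\mathcal{I}(G_k)\bigr]_n\ \cup\ \bigl[\mathrm{h}\mathcal{I}(G_1-v)+\cdots+\mathrm{h}\mathcal{I}(G_k-v)+\{(1,1)\}\bigr]_n .$$ -/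

import Mathlib

open scoped Pointwise

/-- The partial inertia `(π(A), ν(A))` of a Hermitian matrix: the numbers of positive and of
negative eigenvalues, counted with multiplicity. -/
noncomputable def partialInertia {𝕜 V : Type*} [RCLike 𝕜] [Fintype V] [DecidableEq V]
    {A : Matrix V V 𝕜} (hA : A.IsHermitian) : ℕ × ℕ :=
  ((Finset.univ.filter fun i => 0 < hA.eigenvalues i).card,
    (Finset.univ.filter fun i => hA.eigenvalues i < 0).card)

/-- The pattern of off-diagonal nonzero entries of `A` is the graph `G`; the diagonal is free. -/
def HasGraph {𝕜 V : Type*} [Zero 𝕜] (A : Matrix V V 𝕜) (G : SimpleGraph V) : Prop :=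
  ∀ i j, i ≠ j → (A i j ≠ 0 ↔ G.Adj i j)

/-- The partial inertias of all Hermitian matrices over `𝕜` whose graph is `G`. -/
def inertiaSetOver (𝕜 : Type*) {V : Type*} [RCLike 𝕜] [Fintype V] [DecidableEq V]
    (G : SimpleGraph V) : Set (ℕ × ℕ) :=
  {p | ∃ (A : Matrix V V 𝕜) (hA : A.IsHermitian), HasGraph A G ∧ partialInertia hA = p}

/-- The inertia set `I(G)`: partial inertias of the real symmetric matrices with graph `G`. -/
abbrev inertiaSet {V : Type*} [Fintype V] [DecidableEq V] (G : SimpleGraph V) : Set (ℕ × ℕ) :=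
  inertiaSetOver ℝ G

/-- The Hermitian inertia set `hI(G)`: partial inertias of the complex Hermitian matrices with
graph `G`. -/
abbrev hermitianInertiaSet {V : Type*} [Fintype V] [DecidableEq V] (G : SimpleGraph V) :
    Set (ℕ × ℕ) :=
  inertiaSetOver ℂ G

/-- The truncation `[Q]_n = {(r, s) ∈ Q : r + s ≤ n}`. -/
def truncateAt (n : ℕ) (Q : Set (ℕ × ℕ)) : Set (ℕ × ℕ) :=
  {p ∈ Q | p.1 + p.2 ≤ n}

/-- The graph `G - v`. -/
abbrev deleteVertex {V : Type*} (G : SimpleGraph V) (v : V) : SimpleGraph {x : V // x ≠ v} :=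
  G.induce {x | x ≠ v}

/-- The vertices of the vertex sum of graphs on `V i` with marked vertices `w i`: one vertex `none`
for all the marked ones, and a copy of every other vertex of each `V i`. -/
abbrev VertexSumType {ι : Type*} {V : ι → Type*} (w : ∀ i, V i) : Type _ :=
  Option (Σ i, {x : V i // x ≠ w i})

/-- The inclusion of the vertices of the `i`-th graph in the vertices of the vertex sum. -/
noncomputable def vertexSumIncl {ι : Type*} {V : ι → Type*} (w : ∀ i, V i) (i : ι) (x : V i) :
    VertexSumType w :=
  open Classical in if h : x = w i then none else some ⟨i, x, h⟩

/-- The vertex sum of the graphs `G i`, with the marked vertices `w i` identified: its edges are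
the images of the edges of the `G i`. -/
noncomputable def vertexSum {ι : Type*} {V : ι → Type*} (G : ∀ i, SimpleGraph (V i)) (w : ∀ i, V i) :
    SimpleGraph (VertexSumType w) :=
  ⨆ i, (G i).map (vertexSumIncl w i)

/-- `H` is, up to isomorphism, the vertex sum of the graphs `G i` with the marked vertices `w i`
identified to the vertex `v` of `H`. -/
def IsVertexSum {W ι : Type*} {V : ι → Type*} (H : SimpleGraph W) (v : W)
    (G : ∀ i, SimpleGraph (V i)) (w : ∀ i, V i) : Prop :=
  ∃ e : H ≃g vertexSum G w, e v = none

/-! List the common vertex `v` before the others. A matrix with graph `G` then has a real corner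
`a`, a border `b = (b_i)` and a block diagonal remainder `B = ⊕ B_i`, where `B_i` has graph `G_i -
v`.

If `-b = B u` for some `u`, completing the square splits the form into that of `B` and the single
square `(a - u*Bu)|t|²`. The corner `a` can be shared among the summands so that all of them but one
have coefficient zero on this square, and then the inertias of the summands add up exactly.
Otherwise some `z` in the kernel of `B` is not orthogonal to `b`; shifting along `z` makes the
corner arbitrary, and bordering adds exactly `(1, 1)`. This is
`exists_sum_eq_of_mem_inertiaSetOver`.

For the reverse inclusion, the form of `G` is the sum of the forms of the `G_i` restricted to
vectors that agree at `v`, so its indices are at most the sums; and bordering a block adds at most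
`(1, 1)`. The northeast lemma `mem_inertiaSetOver_of_le` then climbs to the required pair within the
bound `n`.

Indices are described by linear maps (`IsPosIndex`) rather than by eigenvalues, so every comparison
reduces to a map between spaces that respects the forms. -/

open scoped Matrix

/-- The positive index of inertia of `q` is `d`: there are a `d`-dimensional space on which `q` is
positive definite and a space of codimension at most `d` on which `q` is nonpositive. -/
def IsPosIndex (𝕜 : Type*) [RCLike 𝕜] {E : Type*} [AddCommGroup E] [Module 𝕜 E]
    (q : E → ℝ) (d : ℕ) : Prop :=
  (∃ R : (Fin d → 𝕜) →ₗ[𝕜] E, ∀ y, y ≠ 0 → 0 < q (R y)) ∧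
    ∃ L : E →ₗ[𝕜] (Fin d → 𝕜), ∀ x, L x = 0 → q x ≤ 0

/-- The partial inertia of `q` is `p`. -/
def IsInertia (𝕜 : Type*) [RCLike 𝕜] {E : Type*} [AddCommGroup E] [Module 𝕜 E]
    (q : E → ℝ) (p : ℕ × ℕ) : Prop :=
  IsPosIndex 𝕜 q p.1 ∧ IsPosIndex 𝕜 (fun x => -q x) p.2

/-! ### Indices of inertia and their comparison along linear maps. -/

section Index

variable {𝕜 : Type*} [RCLike 𝕜] {E E' : Type*} [AddCommGroup E] [Module 𝕜 E]
  [AddCommGroup E'] [Module 𝕜 E']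

lemma IsPosIndex.of_finrank {X Y : Type*} [AddCommGroup X] [Module 𝕜 X] [AddCommGroup Y]
    [Module 𝕜 Y] [FiniteDimensional 𝕜 X] [FiniteDimensional 𝕜 Y] {q : E → ℝ} {d : ℕ}
    (hX : Module.finrank 𝕜 X = d) (hY : Module.finrank 𝕜 Y = d)
    (R : X →ₗ[𝕜] E) (hR : ∀ y, y ≠ 0 → 0 < q (R y))
    (L : E →ₗ[𝕜] Y) (hL : ∀ x, L x = 0 → q x ≤ 0) : IsPosIndex 𝕜 q d := by
  have eX : (Fin d → 𝕜) ≃ₗ[𝕜] X := LinearEquiv.ofFinrankEq _ _ (by simp [hX])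
  have eY : Y ≃ₗ[𝕜] (Fin d → 𝕜) := LinearEquiv.ofFinrankEq _ _ (by simp [hY])
  refine ⟨⟨R ∘ₗ eX.toLinearMap, fun y hy => hR _ (by simpa using hy)⟩,
    ⟨eY.toLinearMap ∘ₗ L, fun x hx => hL x (by simpa using hx)⟩⟩

/-- On the `d`-dimensional space where `q` is positive, `L ∘ C` and `T` have no common nonzero
kernel vector: there `q ≤ q' ∘ C ≤ 0`. So that space embeds in dimension `d' + dim U`. -/
lemma IsPosIndex.le_add_finrank {U : Type*} [AddCommGroup U] [Module 𝕜 U] [FiniteDimensional 𝕜 U]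
    {q : E → ℝ} {q' : E' → ℝ} {d d' : ℕ} (h : IsPosIndex 𝕜 q d) (h' : IsPosIndex 𝕜 q' d')
    (C : E →ₗ[𝕜] E') (T : E →ₗ[𝕜] U) (hC : ∀ x, T x = 0 → q x ≤ q' (C x)) :
    d ≤ d' + Module.finrank 𝕜 U := by
  obtain ⟨⟨R, hR⟩, -⟩ := h
  obtain ⟨-, L, hL⟩ := h'
  have := LinearMap.finrank_le_finrank_of_injective (f := ((L ∘ₗ C).prod T) ∘ₗ R) (by
    rw [← LinearMap.ker_eq_bot, LinearMap.ker_eq_bot']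
    intro y hy
    by_contra hne
    have h1 : L (C (R y)) = 0 := congrArg Prod.fst hy
    have h2 : T (R y) = 0 := congrArg Prod.snd hy
    exact absurd (hR y hne) (not_lt.2 ((hC _ h2).trans (hL _ h1))))
  simpa using this

lemma IsPosIndex.le_of_le {q : E → ℝ} {q' : E' → ℝ} {d d' : ℕ} (h : IsPosIndex 𝕜 q d)
    (h' : IsPosIndex 𝕜 q' d') (C : E →ₗ[𝕜] E') (hC : ∀ x, q x ≤ q' (C x)) : d ≤ d' := by
  simpa using h.le_add_finrank h' C (0 : E →ₗ[𝕜] (Fin 0 → 𝕜)) fun x _ => hC x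

/-- The maps need be neither injective nor mutually inverse, so forms on spaces of different
dimension, with different radicals, can be compared. -/
lemma IsInertia.eq_of_maps {q : E → ℝ} {q' : E' → ℝ} {p p' : ℕ × ℕ} (h : IsInertia 𝕜 q p)
    (h' : IsInertia 𝕜 q' p') (C : E →ₗ[𝕜] E') (hC : ∀ x, q x = q' (C x))
    (D : E' →ₗ[𝕜] E) (hD : ∀ x, q' x = q (D x)) : p = p' := by
  refine Prod.ext (le_antisymm ?_ ?_) (le_antisymm ?_ ?_)
  · exact h.1.le_of_le h'.1 C fun x => (hC x).le
  · exact h'.1.le_of_le h.1 D fun x => (hD x).le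
  · exact h.2.le_of_le h'.2 C fun x => by rw [hC]
  · exact h'.2.le_of_le h.2 D fun x => by rw [hD]

lemma IsPosIndex.congr_equiv {q : E → ℝ} {q' : E' → ℝ} {d : ℕ} (h : IsPosIndex 𝕜 q d)
    (e : E ≃ₗ[𝕜] E') (he : ∀ x, q x = q' (e x)) : IsPosIndex 𝕜 q' d := by
  obtain ⟨⟨R, hR⟩, L, hL⟩ := h
  refine ⟨⟨e.toLinearMap ∘ₗ R, fun y hy => ?_⟩, ⟨L ∘ₗ e.symm.toLinearMap, fun x hx => ?_⟩⟩
  · simpa [← he] using hR y hy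
  · simpa [he] using hL _ hx

lemma IsInertia.congr_equiv {q : E → ℝ} {q' : E' → ℝ} {p : ℕ × ℕ} (h : IsInertia 𝕜 q p)
    (e : E ≃ₗ[𝕜] E') (he : ∀ x, q x = q' (e x)) : IsInertia 𝕜 q' p :=
  ⟨h.1.congr_equiv e he, h.2.congr_equiv e fun x => by rw [he]⟩

lemma IsPosIndex.pi {ι : Type*} [Fintype ι] {F : ι → Type*} [∀ i, AddCommGroup (F i)]
    [∀ i, Module 𝕜 (F i)] {q : ∀ i, F i → ℝ} {d : ι → ℕ} (h : ∀ i, IsPosIndex 𝕜 (q i) (d i))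
    (h0 : ∀ i, q i 0 = 0) :
    IsPosIndex 𝕜 (fun y : ∀ i, F i => ∑ i, q i (y i)) (∑ i, d i) := by
  choose R hR using fun i => (h i).1
  choose L hL using fun i => (h i).2
  -- A nonzero family may have zero components; `h0` makes these contribute nothing instead of
  -- something negative.
  have hR' : ∀ i y, 0 ≤ q i (R i y) := fun i y => by
    by_cases hy : y = 0
    · rw [hy, map_zero, h0]
    · exact (hR i y hy).le
  have hfin : Module.finrank 𝕜 (∀ i, Fin (d i) → 𝕜) = ∑ i, d i := by
    rw [Module.finrank_pi_fintype]; simp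
  refine IsPosIndex.of_finrank hfin hfin
    (LinearMap.pi fun i => R i ∘ₗ LinearMap.proj i) (fun y hy => ?_)
    (LinearMap.pi fun i => L i ∘ₗ LinearMap.proj i) (fun x hx => ?_)
  · obtain ⟨i, hi⟩ := Function.ne_iff.1 hy
    exact Finset.sum_pos' (fun j _ => hR' j _) ⟨i, Finset.mem_univ i, hR i _ hi⟩
  · exact Finset.sum_nonpos fun i _ => hL i _ (congrFun hx i)

lemma IsInertia.pi {ι : Type*} [Fintype ι] {F : ι → Type*} [∀ i, AddCommGroup (F i)]
    [∀ i, Module 𝕜 (F i)] {q : ∀ i, F i → ℝ} {p : ι → ℕ × ℕ} (h : ∀ i, IsInertia 𝕜 (q i) (p i))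
    (h0 : ∀ i, q i 0 = 0) :
    IsInertia 𝕜 (fun y : ∀ i, F i => ∑ i, q i (y i)) (∑ i, p i) := by
  constructor
  · rw [Prod.fst_sum]
    exact IsPosIndex.pi (fun i => (h i).1) h0
  · rw [Prod.snd_sum]
    simpa only [Finset.sum_neg_distrib] using
      IsPosIndex.pi (fun i => (h i).2) (fun i => by simp [h0])

lemma IsPosIndex.prod_norm_sq {q : E → ℝ} {d : ℕ} (h : IsPosIndex 𝕜 q d) (h0 : q 0 = 0) :
    IsPosIndex 𝕜 (fun x : 𝕜 × E => q x.2 + ‖x.1‖ ^ 2) (d + 1) := by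
  obtain ⟨⟨R, hR⟩, L, hL⟩ := h
  have hfin : Module.finrank 𝕜 (𝕜 × (Fin d → 𝕜)) = d + 1 := by simp [add_comm]
  refine IsPosIndex.of_finrank hfin hfin (LinearMap.prodMap LinearMap.id R) ?_
    (LinearMap.prodMap LinearMap.id L) ?_
  · rintro ⟨t, y⟩ hy
    simp only [LinearMap.prodMap_apply, LinearMap.id_apply]
    by_cases h : y = 0
    · have ht : t ≠ 0 := fun ht => hy (by simp [h, ht])
      rw [h, map_zero, h0]
      positivity
    · have := hR y h
      positivity
  · rintro ⟨t, x⟩ hx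
    have h1 : t = 0 := congrArg Prod.fst hx
    have h2 : L x = 0 := congrArg Prod.snd hx
    simpa [h1] using hL x h2

lemma isPosIndex_of_diagonal {ι : Type*} [Fintype ι] (l : ι → ℝ)
    (e : E ≃ₗ[𝕜] (ι → 𝕜)) {q : E → ℝ} (hq : ∀ x, q x = ∑ i, l i * ‖e x i‖ ^ 2) :
    IsPosIndex 𝕜 q (Finset.univ.filter fun i => 0 < l i).card := by
  classical
  have hfin : Module.finrank 𝕜 ({i // 0 < l i} → 𝕜) =
      (Finset.univ.filter fun i => 0 < l i).card := by
    rw [Module.finrank_fintype_fun_eq_card, Fintype.card_subtype]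
  refine IsPosIndex.of_finrank hfin hfin
    (e.symm.toLinearMap ∘ₗ LinearMap.pi fun i =>
      if h : 0 < l i then LinearMap.proj (⟨i, h⟩ : {i // 0 < l i}) else 0) (fun y hy => ?_)
    (LinearMap.funLeft 𝕜 𝕜 (Subtype.val : {i // 0 < l i} → ι) ∘ₗ e.toLinearMap) (fun x hx => ?_)
  · obtain ⟨i, hi⟩ := Function.ne_iff.1 hy
    rw [hq]
    simp only [LinearMap.comp_apply, LinearEquiv.coe_coe, LinearEquiv.apply_symm_apply,
      LinearMap.pi_apply]
    refine Finset.sum_pos' (fun j _ => ?_) ⟨i, Finset.mem_univ _, ?_⟩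
    · split_ifs with h
      · positivity
      · simp
    · rw [dif_pos i.2]
      have := i.2
      have : 0 < ‖y i‖ := norm_pos_iff.2 hi
      simp only [LinearMap.proj_apply, Subtype.coe_eta]
      positivity
  · rw [hq]
    refine Finset.sum_nonpos fun i _ => ?_
    by_cases h : 0 < l i
    · have : e x i = 0 := congrFun hx ⟨i, h⟩
      simp [this]
    · exact mul_nonpos_of_nonpos_of_nonneg (not_lt.1 h) (by positivity)

end Index

/-! ### Quadratic forms of Hermitian matrices and their diagonalization. -/

section Quad

variable {𝕜 V : Type*} [RCLike 𝕜] [Fintype V]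

/-- The quadratic form of a Hermitian matrix. -/
def quadOf (A : Matrix V V 𝕜) (x : V → 𝕜) : ℝ := RCLike.re (star x ⬝ᵥ A *ᵥ x)

@[simp] lemma quadOf_zero (A : Matrix V V 𝕜) : quadOf A 0 = 0 := by simp [quadOf]

lemma quadOf_neg (A : Matrix V V 𝕜) (x : V → 𝕜) : quadOf (-A) x = -quadOf A x := by
  simp [quadOf, Matrix.neg_mulVec]

lemma quadOf_add (A B : Matrix V V 𝕜) (x : V → 𝕜) :
    quadOf (A + B) x = quadOf A x + quadOf B x := by
  simp [quadOf, Matrix.add_mulVec, dotProduct_add]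

variable [DecidableEq V]

lemma quadOf_diagonal (l : V → ℝ) (x : V → 𝕜) :
    quadOf (Matrix.diagonal fun i => (l i : 𝕜)) x = ∑ i, l i * ‖x i‖ ^ 2 := by
  simp only [quadOf, dotProduct, Matrix.mulVec_diagonal, map_sum, Pi.star_apply, RCLike.star_def]
  refine Finset.sum_congr rfl fun i _ => ?_
  rw [mul_left_comm, RCLike.conj_mul]
  norm_cast

lemma exists_diagonalization {A : Matrix V V 𝕜} (hA : A.IsHermitian) :
    ∃ e : (V → 𝕜) ≃ₗ[𝕜] (V → 𝕜), (∀ x, quadOf A x = ∑ i, hA.eigenvalues i * ‖e x i‖ ^ 2) ∧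
      ∀ x, ∑ i, ‖x i‖ ^ 2 = ∑ i, ‖e x i‖ ^ 2 := by
  set U : Matrix V V 𝕜 := (hA.eigenvectorUnitary).1 with hU
  have h1 : star U * U = 1 := Unitary.coe_star_mul_self hA.eigenvectorUnitary
  have h2 : U * star U = 1 := Unitary.coe_mul_star_self hA.eigenvectorUnitary
  -- Used twice: `l` equal to the eigenvalues gives the diagonal form of `A`, and `l = 1` shows that
  -- the change of coordinates preserves the norm.
  have key : ∀ (l : V → ℝ) (x : V → 𝕜),
      quadOf (U * Matrix.diagonal (fun i => (l i : 𝕜)) * star U) x =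
        ∑ i, l i * ‖(star U *ᵥ x) i‖ ^ 2 := by
    intro l x
    rw [← quadOf_diagonal]
    simp only [quadOf, Matrix.star_mulVec, Matrix.star_eq_conjTranspose,
      Matrix.conjTranspose_conjTranspose, ← Matrix.mulVec_mulVec, Matrix.dotProduct_mulVec,
      Matrix.vecMul_vecMul]
  refine ⟨LinearEquiv.ofLinearMap (Matrix.mulVecLin (star U)) (Matrix.mulVecLin U)
    (by rw [← Matrix.mulVecLin_mul, h1, Matrix.mulVecLin_one])
    (by rw [← Matrix.mulVecLin_mul, h2, Matrix.mulVecLin_one]), fun x => ?_, fun x => ?_⟩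
  · have := hA.spectral_theorem
    rw [Unitary.conjStarAlgAut_apply] at this
    have h3 := key hA.eigenvalues x
    simp only [LinearEquiv.coe_ofLinearMap, Matrix.mulVecLin_apply]
    rw [← h3]
    conv_lhs => rw [this]
    rfl
  · have h3 := key (fun _ => 1) x
    have h4 := quadOf_diagonal (𝕜 := 𝕜) (fun _ : V => 1) x
    simp only [LinearEquiv.coe_ofLinearMap, Matrix.mulVecLin_apply]
    simp only [RCLike.ofReal_one, Matrix.diagonal_one, mul_one, one_mul, h2] at h3 h4
    rw [← h3, h4]

lemma isInertia_partialInertia {A : Matrix V V 𝕜} (hA : A.IsHermitian) :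
    IsInertia 𝕜 (quadOf A) (partialInertia hA) := by
  obtain ⟨e, he, -⟩ := exists_diagonalization hA
  refine ⟨isPosIndex_of_diagonal _ e he, ?_⟩
  have := isPosIndex_of_diagonal (fun i => -hA.eigenvalues i) e (q := fun x => -quadOf A x)
    (fun x => by simp [he])
  simpa [partialInertia] using this

lemma partialInertia_add_le {A : Matrix V V 𝕜} (hA : A.IsHermitian) :
    (partialInertia hA).1 + (partialInertia hA).2 ≤ Fintype.card V := by
  rw [partialInertia, ← Finset.card_union_of_disjoint]
  · exact Finset.card_le_univ _
  · rw [Finset.disjoint_filter]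
    intro i _ h
    exact h.le.not_gt

lemma IsInertia.eq {E : Type*} [AddCommGroup E] [Module 𝕜 E] {q : E → ℝ} {p p' : ℕ × ℕ}
    (h : IsInertia 𝕜 q p) (h' : IsInertia 𝕜 q p') : p = p' :=
  h.eq_of_maps h' LinearMap.id (fun _ => rfl) LinearMap.id (fun _ => rfl)

end Quad

/-! ### The northeast lemma. -/

section Northeast

variable {𝕜 V : Type*} [RCLike 𝕜] [Fintype V] [DecidableEq V] {G : SimpleGraph V}

/-- Adding a small multiple of the identity to a Hermitian matrix turns its zero eigenvalues into
positive ones. -/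
lemma exists_shift {A : Matrix V V 𝕜} (hA : A.IsHermitian) :
    ∃ ε : ℝ, 0 < ε ∧ IsInertia 𝕜 (fun x => quadOf A x + ε * ∑ i, ‖x i‖ ^ 2)
      (Fintype.card V - (partialInertia hA).2, (partialInertia hA).2) := by
  obtain ⟨e, he, he'⟩ := exists_diagonalization hA
  -- Any `ε` below the absolute values of all negative eigenvalues works: these stay negative and
  -- all others become positive.
  obtain ⟨ε, hε, hneg⟩ : ∃ ε : ℝ, 0 < ε ∧ ∀ i, hA.eigenvalues i < 0 → hA.eigenvalues i + ε < 0 := by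
    have : ∀ᶠ ε in nhdsWithin (0 : ℝ) (Set.Ioi 0),
        ∀ i, hA.eigenvalues i < 0 → hA.eigenvalues i + ε < 0 := by
      rw [Filter.eventually_all]
      intro i
      by_cases h : hA.eigenvalues i < 0
      · filter_upwards [nhdsWithin_le_nhds (Iio_mem_nhds (neg_pos.2 h))] with ε hε _
        simp only [Set.mem_Iio] at hε
        linarith
      · exact Filter.Eventually.of_forall fun _ h' => absurd h' h
    obtain ⟨ε, h1, h2⟩ := (this.and self_mem_nhdsWithin).exists
    exact ⟨ε, h2, h1⟩
  have hiff : ∀ i, hA.eigenvalues i + ε < 0 ↔ hA.eigenvalues i < 0 := fun i =>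
    ⟨fun h => by linarith, hneg i⟩
  have hiff' : ∀ i, 0 < hA.eigenvalues i + ε ↔ ¬ hA.eigenvalues i < 0 := fun i =>
    ⟨fun h h' => by linarith [hneg i h'], fun h => by linarith⟩
  have hq : ∀ x, quadOf A x + ε * ∑ i, ‖x i‖ ^ 2 =
      ∑ i, (hA.eigenvalues i + ε) * ‖e x i‖ ^ 2 := fun x => by
    rw [he, he', Finset.mul_sum, ← Finset.sum_add_distrib]
    exact Finset.sum_congr rfl fun i _ => by ring
  refine ⟨ε, hε, ?_, ?_⟩
  · have := isPosIndex_of_diagonal _ e hq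
    simp only [hiff', Finset.filter_not, Finset.card_sdiff_of_subset (Finset.filter_subset _ _),
      Finset.card_univ] at this
    exact this
  · have := isPosIndex_of_diagonal (fun i => -(hA.eigenvalues i + ε)) e
      (q := fun x => -(quadOf A x + ε * ∑ i, ‖x i‖ ^ 2)) (fun x => by simp only [hq, neg_mul,
        Finset.sum_neg_distrib])
    simpa only [neg_pos, hiff, partialInertia] using this

/-- Adding `ε` to the diagonal entries one at a time keeps the graph. Each step raises the positive
index by at most one, while the negative index stays `s`, so every positive index from `r` to `|V| -
s` occurs. -/
lemma mem_inertiaSetOver_of_fst_le {r r' s : ℕ} (h : (r, s) ∈ inertiaSetOver 𝕜 G) (hr : r ≤ r')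
    (hn : r' + s ≤ Fintype.card V) : (r', s) ∈ inertiaSetOver 𝕜 G := by
  obtain ⟨A, hA, hAG, hp⟩ := h
  obtain ⟨ε, hε, hsh⟩ := exists_shift hA
  have hin := isInertia_partialInertia hA
  rw [hp] at hsh hin
  set B : Finset V → Matrix V V 𝕜 := fun S =>
    A + Matrix.diagonal fun i => ((if i ∈ S then ε else 0 : ℝ) : 𝕜) with hBdef
  have hB : ∀ S, (B S).IsHermitian := fun S => hA.add (by
    rw [Matrix.isHermitian_diagonal_iff]
    intro i
    simp [IsSelfAdjoint])
  have hBG : ∀ S, HasGraph (B S) G := fun S i j hij => by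
    simpa [hBdef, hij] using hAG i j hij
  have hquad : ∀ S x, quadOf (B S) x = quadOf A x + ε * ∑ i ∈ S, ‖x i‖ ^ 2 := fun S x => by
    rw [hBdef, quadOf_add, quadOf_diagonal]
    simp [Finset.mul_sum, Finset.sum_ite_mem]
  -- The form of `B S` lies between those of `A` and `A + εI`, both of negative index `s`.
  have hnu : ∀ S, (partialInertia (hB S)).2 = s := fun S => by
    refine le_antisymm ?_ ?_
    · refine (isInertia_partialInertia (hB S)).2.le_of_le hin.2 LinearMap.id fun x => ?_
      rw [hquad]
      have : 0 ≤ ε * ∑ i ∈ S, ‖x i‖ ^ 2 := by positivity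
      simpa using this
    · refine hsh.2.le_of_le (isInertia_partialInertia (hB S)).2 LinearMap.id fun x => ?_
      simp only [hquad, LinearMap.id_apply, neg_le_neg_iff, add_le_add_iff_left]
      gcongr
      exact Finset.subset_univ S
  -- A discrete intermediate value argument, by induction on the set of shifted diagonal entries.
  have main : ∀ S : Finset V, ∀ m, r ≤ m → m ≤ (partialInertia (hB S)).1 →
      (m, s) ∈ inertiaSetOver 𝕜 G := by
    intro S
    induction S using Finset.induction_on with
    | empty =>
      intro m h1 h2
      have : (partialInertia (hB ∅)).1 ≤ r :=
        (isInertia_partialInertia (hB ∅)).1.le_of_le hin.1 LinearMap.id fun x => by simp [hquad]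
      obtain rfl : m = r := by omega
      exact ⟨A, hA, hAG, hp⟩
    | insert a S ha ih =>
      intro m h1 h2
      have : (partialInertia (hB (insert a S))).1 ≤ (partialInertia (hB S)).1 + 1 := by
        have := (isInertia_partialInertia (hB (insert a S))).1.le_add_finrank
          (isInertia_partialInertia (hB S)).1 LinearMap.id
          (LinearMap.proj a : (V → 𝕜) →ₗ[𝕜] 𝕜) fun x hx => by
            have hx' : x a = 0 := hx
            simp [hquad, Finset.sum_insert ha, hx']
        simpa using this
      by_cases h3 : m ≤ (partialInertia (hB S)).1
      · exact ih m h1 h3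
      -- Here `m` exceeds the index of `B S` but not that of `B (insert a S)`, which is larger by at
      -- most one; hence `m` is the latter.
      · exact ⟨B (insert a S), hB _, hBG _, Prod.ext (by omega) (hnu _)⟩
  refine main Finset.univ r' hr ?_
  have : Fintype.card V - s ≤ (partialInertia (hB Finset.univ)).1 :=
    hsh.1.le_of_le (isInertia_partialInertia (hB Finset.univ)).1 LinearMap.id fun x => by
      simp [hquad]
  omega

lemma swap_mem_inertiaSetOver {r s : ℕ} (h : (r, s) ∈ inertiaSetOver 𝕜 G) :
    (s, r) ∈ inertiaSetOver 𝕜 G := by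
  obtain ⟨A, hA, hAG, hp⟩ := h
  have hin := isInertia_partialInertia hA
  rw [hp] at hin
  refine ⟨-A, hA.neg, fun i j hij => by simpa using hAG i j hij, ?_⟩
  refine (isInertia_partialInertia hA.neg).eq ⟨?_, ?_⟩
  · exact hin.2.congr_equiv (LinearEquiv.refl 𝕜 _) fun x => by simp [quadOf_neg]
  · exact hin.1.congr_equiv (LinearEquiv.refl 𝕜 _) fun x => by simp [quadOf_neg]

/-- The northeast lemma. -/
lemma mem_inertiaSetOver_of_le {p p' : ℕ × ℕ} (h : p ∈ inertiaSetOver 𝕜 G) (hp : p ≤ p')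
    (hn : p'.1 + p'.2 ≤ Fintype.card V) : p' ∈ inertiaSetOver 𝕜 G := by
  have h1 : (p'.1, p.2) ∈ inertiaSetOver 𝕜 G :=
    mem_inertiaSetOver_of_fst_le h hp.1 (by have := hp.2; omega)
  exact swap_mem_inertiaSetOver (mem_inertiaSetOver_of_fst_le (swap_mem_inertiaSetOver h1) hp.2
    (by omega))

end Northeast

/-! ### Bordered Hermitian forms. -/

section Border

variable {𝕜 : Type*} [RCLike 𝕜] {S V : Type*} [Fintype S] [Fintype V]

/-- The quadratic form of the Hermitian matrix with corner `a`, first column `b` and remaining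
block `B`. -/
def borderForm (a : ℝ) (b : S → 𝕜) (B : Matrix S S 𝕜) (x : 𝕜 × (S → 𝕜)) : ℝ :=
  a * ‖x.1‖ ^ 2 + 2 * RCLike.re (star x.1 * (star b ⬝ᵥ x.2)) + quadOf B x.2

@[simp] lemma borderForm_zero (a : ℝ) (b : S → 𝕜) (B : Matrix S S 𝕜) : borderForm a b B 0 = 0 := by
  simp [borderForm]

/-- Functions on `V` are pairs of a value at a marked point and a function on the other points. -/
def splitEquiv (𝕜 : Type*) [RCLike 𝕜] {S V : Type*} (e : Option S ≃ V) :
    (V → 𝕜) ≃ₗ[𝕜] 𝕜 × (S → 𝕜) where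
  toFun x := (x (e none), fun s => x (e (some s)))
  invFun y v := (e.symm v).elim y.1 y.2
  map_add' _ _ := rfl
  map_smul' _ _ := rfl
  left_inv x := by
    funext v
    obtain ⟨o, rfl⟩ := e.surjective v
    cases o <;> simp
  right_inv y := by simp

lemma quadOf_eq_borderForm (e : Option S ≃ V) {A : Matrix V V 𝕜} (hA : A.IsHermitian)
    (x : V → 𝕜) :
    quadOf A x = borderForm (RCLike.re (A (e none) (e none))) (fun s => A (e (some s)) (e none))
      (A.submatrix (fun s => e (some s)) (fun s => e (some s))) (splitEquiv 𝕜 e x) := by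
  have hs : ∀ i j, A i j = star (A j i) := fun i j => (hA.apply i j).symm
  have h1 : RCLike.re (∑ s, star (x (e (some s))) * (A (e (some s)) (e none) * x (e none))) =
      RCLike.re (star (x (e none)) * ∑ s, star (A (e (some s)) (e none)) * x (e (some s))) := by
    rw [← RCLike.conj_re, map_sum, Finset.mul_sum]
    congr 1
    refine Finset.sum_congr rfl fun s _ => ?_
    simp only [RCLike.star_def, map_mul, RCLike.conj_conj]
    ring
  have h2 : RCLike.re (star (x (e none)) * (A (e none) (e none) * x (e none))) =
      RCLike.re (A (e none) (e none)) * ‖x (e none)‖ ^ 2 := by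
    rw [mul_left_comm, RCLike.star_def, RCLike.conj_mul, ← RCLike.ofReal_pow, RCLike.re_mul_ofReal]
  simp only [quadOf, dotProduct, Matrix.mulVec, borderForm, splitEquiv, LinearEquiv.coe_mk,
    LinearMap.coe_mk, AddHom.coe_mk, ← e.sum_comp, Fintype.sum_option, mul_add,
    Finset.sum_add_distrib, map_add, Pi.star_apply, Matrix.submatrix_apply]
  rw [h1, h2]
  simp only [fun s => hs (e none) (e (some s))]
  ring

/-- The Hermitian matrix with corner `a`, first column `b` and remaining block `B`. -/
def borderMatrix (a : ℝ) (b : S → 𝕜) (B : Matrix S S 𝕜) : Matrix (Option S) (Option S) 𝕜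
  | none, none => a
  | none, some s => star (b s)
  | some s, none => b s
  | some s, some t => B s t

omit [Fintype S] in
lemma borderMatrix_isHermitian (a : ℝ) (b : S → 𝕜) {B : Matrix S S 𝕜} (hB : B.IsHermitian) :
    (borderMatrix a b B).IsHermitian := by
  ext i j
  cases i <;> cases j <;> simp [borderMatrix, Matrix.conjTranspose_apply]
  exact hB.apply _ _

lemma quadOf_borderMatrix (e : Option S ≃ V) (a : ℝ) (b : S → 𝕜) {B : Matrix S S 𝕜}
    (hB : B.IsHermitian) (x : V → 𝕜) :
    quadOf ((borderMatrix a b B).submatrix e.symm e.symm) x =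
      borderForm a b B (splitEquiv 𝕜 e x) := by
  rw [quadOf_eq_borderForm e ((borderMatrix_isHermitian a b hB).submatrix e.symm)]
  congr 1
  · simp [borderMatrix]
  · simp [borderMatrix]
  · ext; simp [borderMatrix]

lemma exists_isInertia_borderForm (a : ℝ) (b : S → 𝕜) {B : Matrix S S 𝕜} (hB : B.IsHermitian) :
    ∃ p, IsInertia 𝕜 (borderForm a b B) p := by
  classical
  exact ⟨_, (isInertia_partialInertia ((borderMatrix_isHermitian a b hB).submatrix
    (Equiv.refl _).symm)).congr_equiv (splitEquiv 𝕜 (Equiv.refl _))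
    (quadOf_borderMatrix (Equiv.refl _) a b hB)⟩

variable [DecidableEq V]

/-- Inertias of matrices with graph `G` are inertias of bordered forms. -/
lemma exists_borderForm_of_mem {G : SimpleGraph V} (e : Option S ≃ V) {p : ℕ × ℕ}
    (h : p ∈ inertiaSetOver 𝕜 G) :
    ∃ (a : ℝ) (b : S → 𝕜) (B : Matrix S S 𝕜), B.IsHermitian ∧
      (∀ s, b s ≠ 0 ↔ G.Adj (e none) (e (some s))) ∧
      HasGraph B (G.comap fun s => e (some s)) ∧ IsInertia 𝕜 (borderForm a b B) p := by
  obtain ⟨A, hA, hAG, rfl⟩ := h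
  refine ⟨_, _, _, hA.submatrix _, fun s => ?_, fun i j hij => ?_,
    (isInertia_partialInertia hA).congr_equiv (splitEquiv 𝕜 e) (quadOf_eq_borderForm e hA)⟩
  · rw [hAG _ _ (by simp), G.adj_comm]
  · exact hAG _ _ (by simpa using hij)

/-- Bordered forms with the pattern of `G` have their inertias in the inertia set of `G`. -/
lemma exists_mem_of_borderForm {G : SimpleGraph V} (e : Option S ≃ V) (a : ℝ) (b : S → 𝕜)
    {B : Matrix S S 𝕜} (hB : B.IsHermitian) (hb : ∀ s, b s ≠ 0 ↔ G.Adj (e none) (e (some s)))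
    (hBG : HasGraph B (G.comap fun s => e (some s))) :
    ∃ p ∈ inertiaSetOver 𝕜 G, IsInertia 𝕜 (borderForm a b B) p := by
  have hA := (borderMatrix_isHermitian a b hB).submatrix e.symm
  refine ⟨_, ⟨_, hA, fun i j hij => ?_, rfl⟩, (isInertia_partialInertia hA).congr_equiv
    (splitEquiv 𝕜 e) (quadOf_borderMatrix e a b hB)⟩
  · obtain ⟨i, rfl⟩ := e.surjective i
    obtain ⟨j, rfl⟩ := e.surjective j
    rcases i with _ | i <;> rcases j with _ | j
    · exact absurd rfl hij
    · simpa [borderMatrix] using hb j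
    · simpa [borderMatrix, G.adj_comm] using hb i
    · simpa [borderMatrix] using hBG i j (by simpa using hij)

lemma star_dotProduct_mulVec {B : Matrix S S 𝕜} (hB : B.IsHermitian) (x y : S → 𝕜) :
    star x ⬝ᵥ B *ᵥ y = star (star y ⬝ᵥ B *ᵥ x) := by
  rw [Matrix.star_dotProduct, Matrix.star_mulVec, hB.eq, Matrix.dotProduct_mulVec]

lemma quadOf_add_smul {B : Matrix S S 𝕜} (hB : B.IsHermitian) (x y : S → 𝕜) (c : 𝕜) :
    quadOf B (x + c • y) =
      quadOf B x + 2 * RCLike.re (star c * (star y ⬝ᵥ B *ᵥ x)) + ‖c‖ ^ 2 * quadOf B y := by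
  have h1 : RCLike.re (c * (star x ⬝ᵥ B *ᵥ y)) = RCLike.re (star c * (star y ⬝ᵥ B *ᵥ x)) := by
    rw [star_dotProduct_mulVec hB x y, ← RCLike.conj_re]
    simp
  have h2 : RCLike.re (c * (star c * (star y ⬝ᵥ B *ᵥ y))) =
      ‖c‖ ^ 2 * RCLike.re (star y ⬝ᵥ B *ᵥ y) := by
    rw [← mul_assoc, RCLike.star_def, RCLike.mul_conj, ← RCLike.ofReal_pow, RCLike.re_ofReal_mul]
  simp only [quadOf, Matrix.mulVec_add, Matrix.mulVec_smul, star_add, star_smul, add_dotProduct,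
    dotProduct_add, dotProduct_smul, smul_dotProduct, smul_eq_mul, map_add, mul_add]
  rw [h1, h2]
  ring

/-- Completing the square in a bordered form whose border is in the range of the block. -/
lemma borderForm_of_mulVec_eq {a : ℝ} {b u : S → 𝕜} {B : Matrix S S 𝕜} (hB : B.IsHermitian)
    (hu : B *ᵥ u = -b) (x : 𝕜 × (S → 𝕜)) :
    borderForm a b B x = quadOf B (x.2 + (-x.1) • u) + (a - quadOf B u) * ‖x.1‖ ^ 2 := by
  have h : star u ⬝ᵥ B *ᵥ x.2 = -(star b ⬝ᵥ x.2) := by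
    rw [Matrix.dotProduct_mulVec]
    nth_rw 1 [← hB.eq]
    rw [← Matrix.star_mulVec, hu, star_neg, neg_dotProduct]
  rw [quadOf_add_smul hB, h, borderForm]
  simp only [star_neg, neg_mul_neg, norm_neg]
  ring

/-- Moving along a kernel vector `z` leaves the value of `B` unchanged but gives `star b ⬝ᵥ x.2` any
desired value. Setting it to `(c - a) / 2 * x.1` turns the cross term into `(c - a)‖x.1‖²`, which
replaces the corner `a` by `c`. -/
lemma borderForm_add_smul_isotropic {a c : ℝ} {b z : S → 𝕜} {B : Matrix S S 𝕜}
    (hB : B.IsHermitian) (hz : B *ᵥ z = 0) (hbz : star b ⬝ᵥ z ≠ 0) (x : 𝕜 × (S → 𝕜)) :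
    borderForm a b B (x.1, x.2 + ((((c - a) / 2 : ℝ) : 𝕜) * x.1 - star b ⬝ᵥ x.2) •
      (star b ⬝ᵥ z)⁻¹ • z) = quadOf B x.2 + c * ‖x.1‖ ^ 2 := by
  have h : star z ⬝ᵥ B *ᵥ x.2 = 0 := by
    rw [star_dotProduct_mulVec hB, hz]; simp
  have h' : quadOf B z = 0 := by simp [quadOf, hz]
  rw [borderForm, smul_smul, quadOf_add_smul hB, h, h', dotProduct_add, dotProduct_smul,
    smul_eq_mul, mul_assoc, inv_mul_cancel₀ hbz, mul_one, add_sub_cancel]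
  simp only [mul_zero, map_zero, add_zero]
  have : RCLike.re (star x.1 * ((((c - a) / 2 : ℝ) : 𝕜) * x.1)) = (c - a) / 2 * ‖x.1‖ ^ 2 := by
    rw [mul_left_comm, RCLike.star_def, RCLike.conj_mul, ← RCLike.ofReal_pow,
      RCLike.re_ofReal_mul, RCLike.ofReal_re]
  rw [this]
  ring

/-- A vector outside the range of a Hermitian matrix is not orthogonal to its kernel. -/
lemma exists_mulVec_eq_or (b : S → 𝕜) {B : Matrix S S 𝕜} (hB : B.IsHermitian) :
    (∃ u, B *ᵥ u = -b) ∨ ∃ z, B *ᵥ z = 0 ∧ star b ⬝ᵥ z ≠ 0 := by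
  classical
  by_cases h : -b ∈ LinearMap.range B.mulVecLin
  · exact Or.inl h
  right
  obtain ⟨f, hf, hBf⟩ := Submodule.exists_le_ker_of_notMem h
  obtain ⟨c, hc⟩ : ∃ c : S → 𝕜, ∀ x, f x = c ⬝ᵥ x :=
    ⟨fun s => f fun j => if s = j then 1 else 0, fun x => by
      rw [LinearMap.pi_apply_eq_sum_univ f x]
      simp [dotProduct, mul_comm]⟩
  -- The row `c` represents a functional that kills the range of `B` but not `-b`; since `B` is
  -- Hermitian, its conjugate is a kernel vector.
  refine ⟨star c, ?_, fun h0 => hf ?_⟩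
  · have : c ᵥ* B = 0 := by
      funext j
      have : f (B *ᵥ Pi.single j 1) = 0 := hBf ⟨_, rfl⟩
      rw [hc, Matrix.dotProduct_mulVec, dotProduct_single_one] at this
      exact this
    rw [← star_star (B *ᵥ star c), Matrix.star_mulVec, star_star, hB.eq, this, star_zero]
  · rw [Matrix.star_dotProduct_star, star_eq_zero] at h0
    rw [hc, dotProduct_neg, h0, neg_zero]

end Border

/-! ### Block diagonal forms. -/

section Blocks

variable {𝕜 : Type*} [RCLike 𝕜] {ι : Type*} [Fintype ι] [DecidableEq ι] {S : ι → Type*}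
  [∀ i, Fintype (S i)]

lemma quadOf_blockDiagonal' (B : ∀ i, Matrix (S i) (S i) 𝕜) (y : (Σ i, S i) → 𝕜) :
    quadOf (Matrix.blockDiagonal' B) y = ∑ i, quadOf (B i) fun s => y ⟨i, s⟩ := by
  simp only [quadOf, dotProduct, Matrix.mulVec, Fintype.sum_sigma, map_sum]
  refine Finset.sum_congr rfl fun i _ => Finset.sum_congr rfl fun s _ => ?_
  rw [Finset.sum_eq_single_of_mem i (Finset.mem_univ i)]
  · simp [Matrix.blockDiagonal'_apply_eq]
  · intro j _ hj
    simp [Matrix.blockDiagonal'_apply_ne _ _ _ hj.symm]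

/-- However the corner is split, the bordered block diagonal form is the sum of the bordered forms
of the blocks, all sharing the value `x.1`. The freedom in the splitting is what the vertex sum
formula exploits. -/
lemma borderForm_blockDiagonal' (a : ι → ℝ) (b : (Σ i, S i) → 𝕜)
    (B : ∀ i, Matrix (S i) (S i) 𝕜) (x : 𝕜 × ((Σ i, S i) → 𝕜)) :
    borderForm (∑ i, a i) b (Matrix.blockDiagonal' B) x =
      ∑ i, borderForm (a i) (fun s => b ⟨i, s⟩) (B i) (x.1, fun s => x.2 ⟨i, s⟩) := by
  simp only [borderForm, Finset.sum_add_distrib, quadOf_blockDiagonal', Finset.sum_mul,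
    ← Finset.mul_sum, ← map_sum]
  simp only [dotProduct, Fintype.sum_sigma, Pi.star_apply]

omit [Fintype ι] [∀ i, Fintype (S i)] in
lemma blockDiagonal'_isHermitian {B : ∀ i, Matrix (S i) (S i) 𝕜} (hB : ∀ i, (B i).IsHermitian) :
    (Matrix.blockDiagonal' B).IsHermitian := by
  rw [Matrix.IsHermitian, Matrix.blockDiagonal'_conjTranspose]
  exact congrArg _ (funext fun i => hB i)

lemma isInertia_quadOf_blockDiagonal' {B : ∀ i, Matrix (S i) (S i) 𝕜} {p : ι → ℕ × ℕ}
    (h : ∀ i, IsInertia 𝕜 (quadOf (B i)) (p i)) :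
    IsInertia 𝕜 (quadOf (Matrix.blockDiagonal' B)) (∑ i, p i) :=
  (IsInertia.pi h fun i => quadOf_zero _).congr_equiv
    (LinearEquiv.piCurry 𝕜 (fun (i : ι) (_ : S i) => 𝕜)).symm fun x => by
      rw [quadOf_blockDiagonal']; rfl

end Blocks

/-! ### Adjacency in the vertex sum and the block diagonal pattern. -/

section VertexSum

variable {ι : Type*} {V : ι → Type*} (G : ∀ i, SimpleGraph (V i)) (w : ∀ i, V i)

@[simp] lemma vertexSumIncl_self (i : ι) : vertexSumIncl w i (w i) = none := by
  simp [vertexSumIncl]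

@[simp] lemma vertexSumIncl_coe {i : ι} (x : {x : V i // x ≠ w i}) :
    vertexSumIncl w i x = some ⟨i, x⟩ := by
  simp [vertexSumIncl, x.2]

lemma vertexSumIncl_eq_none_iff {i : ι} {x : V i} : vertexSumIncl w i x = none ↔ x = w i := by
  simp [vertexSumIncl]

/-- The conclusion is an equality in the sigma type so that `cases` identifies the summand and the
vertex together. -/
lemma vertexSumIncl_eq_some {i j : ι} {x : V i} {y : {x : V j // x ≠ w j}}
    (h : vertexSumIncl w i x = some ⟨j, y⟩) : (⟨i, x⟩ : Σ i, V i) = ⟨j, y⟩ := by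
  unfold vertexSumIncl at h
  split_ifs at h with hx
  simp only [Option.some.injEq] at h
  exact congrArg (fun s : Σ i, {x : V i // x ≠ w i} => (⟨s.1, s.2⟩ : Σ i, V i)) h

lemma vertexSum_adj_iff {a b : VertexSumType w} : (vertexSum G w).Adj a b ↔
    a ≠ b ∧ ∃ i x y, (G i).Adj x y ∧ vertexSumIncl w i x = a ∧ vertexSumIncl w i y = b := by
  simp only [vertexSum, SimpleGraph.iSup_adj]
  constructor
  · rintro ⟨i, hne, x, y, h⟩
    exact ⟨hne, i, x, y, h⟩
  · rintro ⟨hne, i, x, y, h⟩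
    exact ⟨i, hne, x, y, h⟩

lemma vertexSum_adj_none_some {i : ι} {x : {x : V i // x ≠ w i}} :
    (vertexSum G w).Adj none (some ⟨i, x⟩) ↔ (G i).Adj (w i) x := by
  rw [vertexSum_adj_iff]
  constructor
  · rintro ⟨-, j, y, z, h, hy, hz⟩
    rw [vertexSumIncl_eq_none_iff] at hy
    cases vertexSumIncl_eq_some w hz
    exact hy ▸ h
  · exact fun h => ⟨by simp, i, _, _, h, by simp, by simp⟩

lemma vertexSum_adj_some_some {i : ι} {x y : {x : V i // x ≠ w i}} :
    (vertexSum G w).Adj (some ⟨i, x⟩) (some ⟨i, y⟩) ↔ (G i).Adj x y := by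
  rw [vertexSum_adj_iff]
  constructor
  · rintro ⟨-, j, z, z', h, hz, hz'⟩
    cases vertexSumIncl_eq_some w hz
    cases vertexSumIncl_eq_some w hz'
    exact h
  · exact fun h => ⟨fun heq => h.ne (by simpa [Subtype.ext_iff] using heq), i, _, _, h, by simp,
      by simp⟩

lemma not_vertexSum_adj_some_some {i j : ι} (hij : i ≠ j) (x : {x : V i // x ≠ w i})
    (y : {x : V j // x ≠ w j}) : ¬ (vertexSum G w).Adj (some ⟨i, x⟩) (some ⟨j, y⟩) := by
  rw [vertexSum_adj_iff]
  rintro ⟨-, k, z, z', h, hz, hz'⟩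
  cases vertexSumIncl_eq_some w hz
  cases vertexSumIncl_eq_some w hz'
  exact hij rfl

variable {𝕜 : Type*} [RCLike 𝕜] [DecidableEq ι]

/-- Block diagonal matrices have the pattern of the vertex sum without the common vertex if and
only if their blocks have the patterns of the summands without their marked vertices. -/
lemma hasGraph_blockDiagonal'_iff (B : ∀ i, Matrix {x : V i // x ≠ w i} {x : V i // x ≠ w i} 𝕜) :
    HasGraph (Matrix.blockDiagonal' B) ((vertexSum G w).comap some) ↔
      ∀ i, HasGraph (B i) (deleteVertex (G i) (w i)) := by
  constructor
  · intro h i x y hxy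
    have := h ⟨i, x⟩ ⟨i, y⟩ (by simpa using hxy)
    rw [Matrix.blockDiagonal'_apply_eq, SimpleGraph.comap_adj, vertexSum_adj_some_some] at this
    exact this
  · rintro h ⟨i, x⟩ ⟨j, y⟩ hxy
    rw [SimpleGraph.comap_adj]
    by_cases hij : i = j
    · subst hij
      rw [Matrix.blockDiagonal'_apply_eq, vertexSum_adj_some_some]
      exact h i x y (by simpa using hxy)
    · simp [Matrix.blockDiagonal'_apply_ne _ _ _ hij, not_vertexSum_adj_some_some G w hij]

lemma eq_blockDiagonal'_of_hasGraph
    {B : Matrix (Σ i, {x : V i // x ≠ w i}) (Σ i, {x : V i // x ≠ w i}) 𝕜}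
    (h : HasGraph B ((vertexSum G w).comap some)) :
    B = Matrix.blockDiagonal' (Matrix.blockDiag' B) := by
  ext ⟨i, x⟩ ⟨j, y⟩
  by_cases hij : i = j
  · subst hij
    rw [Matrix.blockDiagonal'_apply_eq, Matrix.blockDiag'_apply]
  · rw [Matrix.blockDiagonal'_apply_ne _ _ _ hij]
    by_contra hne
    exact not_vertexSum_adj_some_some G w hij x y
      ((h ⟨i, x⟩ ⟨j, y⟩ (fun heq => hij (congrArg Sigma.fst heq))).1 hne)

end VertexSum

/-! ### Matrices of a vertex sum as bordered block diagonal forms. -/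

section InertiaOfVertexSum

variable {𝕜 : Type*} [RCLike 𝕜] {W ι : Type*} [Fintype W] [DecidableEq W] [Fintype ι]
  [DecidableEq ι] {V : ι → Type*} [∀ i, Fintype (V i)] [∀ i, DecidableEq (V i)]
  {H : SimpleGraph W} {v : W} {G : ∀ i, SimpleGraph (V i)} {w : ∀ i, V i}

lemma mem_inertiaSetOver_iff_of_isVertexSum (hH : IsVertexSum H v G w) {p : ℕ × ℕ} :
    p ∈ inertiaSetOver 𝕜 H ↔ ∃ (a : ℝ) (b : (Σ i, {x : V i // x ≠ w i}) → 𝕜)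
      (B : ∀ i, Matrix {x : V i // x ≠ w i} {x : V i // x ≠ w i} 𝕜), (∀ i, (B i).IsHermitian) ∧
      (∀ i x, b ⟨i, x⟩ ≠ 0 ↔ (G i).Adj (w i) x) ∧
      (∀ i, HasGraph (B i) (deleteVertex (G i) (w i))) ∧
      IsInertia 𝕜 (borderForm a b (Matrix.blockDiagonal' B)) p := by
  obtain ⟨f, -⟩ := hH
  have hcomap : (H.comap fun s => f.symm.toEquiv (some s)) = (vertexSum G w).comap some := by
    ext s t
    exact f.symm.map_adj_iff
  have hadj : ∀ s, H.Adj (f.symm.toEquiv none) (f.symm.toEquiv (some s)) ↔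
      (vertexSum G w).Adj none (some s) := fun s => f.symm.map_adj_iff
  constructor
  · intro h
    obtain ⟨a, b, B, hB, hb, hBG, hin⟩ := exists_borderForm_of_mem f.symm.toEquiv h
    rw [hcomap] at hBG
    have hBd := eq_blockDiagonal'_of_hasGraph G w hBG
    rw [hBd] at hBG hin
    exact ⟨a, b, _, fun i => hB.submatrix _, fun i x => by
      rw [hb, hadj, vertexSum_adj_none_some], (hasGraph_blockDiagonal'_iff G w _).1 hBG, hin⟩
  · rintro ⟨a, b, B, hB, hb, hBG, hin⟩
    obtain ⟨p', hp', hin'⟩ := exists_mem_of_borderForm (G := H) f.symm.toEquiv a b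
      (blockDiagonal'_isHermitian hB)
      (fun ⟨i, x⟩ => by rw [hb, hadj, vertexSum_adj_none_some])
      (by rw [hcomap]; exact (hasGraph_blockDiagonal'_iff G w _).2 hBG)
    rwa [hin.eq hin']

end InertiaOfVertexSum

/-! ### The two inclusions of the inertia formula. -/

section InertiaFormula

variable {𝕜 : Type*} [RCLike 𝕜] {W ι : Type*} [Fintype W] [DecidableEq W] [Fintype ι]
  [DecidableEq ι] {V : ι → Type*} [∀ i, Fintype (V i)] [∀ i, DecidableEq (V i)]
  {H : SimpleGraph W} {v : W} {G : ∀ i, SimpleGraph (V i)} {w : ∀ i, V i}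

lemma hasGraph_comap_optionSubtypeNe {V : Type*} [DecidableEq V] {G : SimpleGraph V} {w : V}
    {B : Matrix {x : V // x ≠ w} {x : V // x ≠ w} 𝕜} :
    HasGraph B (G.comap fun s => Equiv.optionSubtypeNe w (some s)) ↔
      HasGraph B (deleteVertex G w) := by
  simp [HasGraph]

/-- Restriction of a function on the vertex sum to the summands. -/
def restrictSummands (𝕜 : Type*) [RCLike 𝕜] {ι : Type*} (S : ι → Type*) :
    𝕜 × ((Σ i, S i) → 𝕜) →ₗ[𝕜] (∀ i, 𝕜 × (S i → 𝕜)) where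
  toFun x i := (x.1, fun s => x.2 ⟨i, s⟩)
  map_add' _ _ := rfl
  map_smul' _ _ := rfl

/-- Functions on the summands are glued after the values at the common vertex are made equal to
the value in the `j`-th summand, by adding multiples of vectors with value `1` there. -/
def glueSummands {𝕜 : Type*} [RCLike 𝕜] {ι : Type*} {S : ι → Type*} (j : ι)
    (u : (Σ i, S i) → 𝕜) : (∀ i, 𝕜 × (S i → 𝕜)) →ₗ[𝕜] 𝕜 × ((Σ i, S i) → 𝕜) where
  toFun y := ((y j).1, fun s => (y s.1).2 s.2 + ((y j).1 - (y s.1).1) * u s)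
  map_add' y z := by
    ext s
    · rfl
    · simp only [Pi.add_apply, Prod.fst_add, Prod.snd_add]; ring
  map_smul' c y := by
    ext s
    · rfl
    · simp only [Pi.smul_apply, Prod.smul_fst, Prod.smul_snd, smul_eq_mul, RingHom.id_apply]; ring

/-- Gluing the matrices and adding their corners gives the pullback of the product form along
`restrictSummands`. Its indices can only be smaller, and the northeast lemma makes up the
difference. -/
lemma sum_mem_inertiaSetOver (hH : IsVertexSum H v G w) {p : ι → ℕ × ℕ}
    (hp : ∀ i, p i ∈ inertiaSetOver 𝕜 (G i))
    (hn : (∑ i, p i).1 + (∑ i, p i).2 ≤ Fintype.card W) : ∑ i, p i ∈ inertiaSetOver 𝕜 H := by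
  choose a b B hB hb hBG hin using fun i =>
    exists_borderForm_of_mem (Equiv.optionSubtypeNe (w i)) (hp i)
  obtain ⟨p', hp'⟩ := exists_isInertia_borderForm (∑ i, a i)
    (fun s : Σ i, {x : V i // x ≠ w i} => b s.1 s.2) (blockDiagonal'_isHermitian hB)
  have hmem : p' ∈ inertiaSetOver 𝕜 H :=
    (mem_inertiaSetOver_iff_of_isVertexSum hH).2 ⟨_, _, B, hB, fun i x => by rw [hb]; simp,
      fun i => hasGraph_comap_optionSubtypeNe.1 (hBG i), hp'⟩
  have hprod := IsInertia.pi hin fun i => borderForm_zero _ _ _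
  refine mem_inertiaSetOver_of_le hmem ⟨?_, ?_⟩ hn
  · refine hp'.1.le_of_le hprod.1 (restrictSummands 𝕜 _) fun x => ?_
    rw [borderForm_blockDiagonal']; rfl
  · refine hp'.2.le_of_le hprod.2 (restrictSummands 𝕜 _) fun x => ?_
    rw [borderForm_blockDiagonal']; rfl

/-- On the hyperplane `x.1 = 0` the bordered form is the form of the block, and one linear condition
costs at most one in each index. -/
lemma IsInertia.borderForm_le {S : Type*} [Fintype S] {a : ℝ} {b : S → 𝕜} {B : Matrix S S 𝕜}
    {p p' : ℕ × ℕ} (h : IsInertia 𝕜 (borderForm a b B) p) (h' : IsInertia 𝕜 (quadOf B) p') :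
    p ≤ p' + (1, 1) := by
  constructor
  · simpa using h.1.le_add_finrank h'.1 (LinearMap.snd 𝕜 𝕜 _) (LinearMap.fst 𝕜 𝕜 _)
      fun x (hx : x.1 = 0) => by simp [borderForm, hx]
  · simpa using h.2.le_add_finrank h'.2 (LinearMap.snd 𝕜 𝕜 _) (LinearMap.fst 𝕜 𝕜 _)
      fun x (hx : x.1 = 0) => by simp [borderForm, hx]

/-- If the border is not in the range of the block, then bordering adds a hyperbolic plane. -/
lemma IsInertia.borderForm_eq {S : Type*} [Fintype S] {a : ℝ} {b z : S → 𝕜} {B : Matrix S S 𝕜}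
    {p p' : ℕ × ℕ} (h : IsInertia 𝕜 (borderForm a b B) p) (h' : IsInertia 𝕜 (quadOf B) p')
    (hB : B.IsHermitian) (hz : B *ᵥ z = 0) (hbz : star b ⬝ᵥ z ≠ 0) : p = p' + (1, 1) := by
  -- The corner `c` is free: `c = 1` exhibits an extra positive square and `c = -1` an extra
  -- negative one.
  have key : ∀ c : ℝ, ∃ D : 𝕜 × (S → 𝕜) →ₗ[𝕜] 𝕜 × (S → 𝕜),
      ∀ x, borderForm a b B (D x) = quadOf B x.2 + c * ‖x.1‖ ^ 2 := fun c =>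
    ⟨{ toFun := fun x => (x.1, x.2 + ((((c - a) / 2 : ℝ) : 𝕜) * x.1 - star b ⬝ᵥ x.2) •
        (star b ⬝ᵥ z)⁻¹ • z)
       map_add' := fun x y => by
        ext s
        · rfl
        · simp only [Prod.fst_add, Prod.snd_add, dotProduct_add, Pi.add_apply, Pi.smul_apply,
            smul_eq_mul]
          ring
       map_smul' := fun r x => by
        ext s
        · rfl
        · simp only [Prod.smul_fst, Prod.smul_snd, dotProduct_smul, Pi.add_apply, Pi.smul_apply,
            smul_eq_mul, RingHom.id_apply]
          ring },
      fun x => borderForm_add_smul_isotropic hB hz hbz x⟩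
  refine le_antisymm (h.borderForm_le h') ⟨?_, ?_⟩
  · obtain ⟨D, hD⟩ := key 1
    exact (h'.1.prod_norm_sq (quadOf_zero B)).le_of_le h.1 D fun x => by simp [hD]
  · obtain ⟨D, hD⟩ := key (-1)
    refine (h'.2.prod_norm_sq (by simp)).le_of_le h.2 D fun x => ?_
    rw [hD]
    linarith

lemma sum_add_mem_inertiaSetOver (hH : IsVertexSum H v G w) {p : ι → ℕ × ℕ}
    (hp : ∀ i, p i ∈ inertiaSetOver 𝕜 (deleteVertex (G i) (w i)))
    (hn : (∑ i, p i + (1, 1)).1 + (∑ i, p i + (1, 1)).2 ≤ Fintype.card W) :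
    ∑ i, p i + (1, 1) ∈ inertiaSetOver 𝕜 H := by
  classical
  choose B hB hBG hin using hp
  -- Any border with the right zero pattern would do, as only the upper bound on its inertia is
  -- needed.
  obtain ⟨p', hp'⟩ := exists_isInertia_borderForm 0
    (fun s : Σ i, {x : V i // x ≠ w i} => if (G s.1).Adj (w s.1) s.2 then (1 : 𝕜) else 0)
    (blockDiagonal'_isHermitian hB)
  have hmem : p' ∈ inertiaSetOver 𝕜 H :=
    (mem_inertiaSetOver_iff_of_isVertexSum hH).2 ⟨_, _, B, hB, fun i x => by simp, hBG, hp'⟩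
  exact mem_inertiaSetOver_of_le hmem (hp'.borderForm_le (isInertia_quadOf_blockDiagonal'
    fun i => hin i ▸ isInertia_partialInertia (hB i))) hn

/-- The two alternatives correspond to whether the border lies in the range of the block diagonal
part. -/
lemma exists_sum_eq_of_mem_inertiaSetOver [Nonempty ι] (hH : IsVertexSum H v G w) {p : ℕ × ℕ}
    (hp : p ∈ inertiaSetOver 𝕜 H) :
    (∃ q : ι → ℕ × ℕ, (∀ i, q i ∈ inertiaSetOver 𝕜 (G i)) ∧ ∑ i, q i = p) ∨
      ∃ q : ι → ℕ × ℕ, (∀ i, q i ∈ inertiaSetOver 𝕜 (deleteVertex (G i) (w i))) ∧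
        ∑ i, q i + (1, 1) = p := by
  obtain ⟨a, b, B, hB, hb, hBG, hin⟩ := (mem_inertiaSetOver_iff_of_isVertexSum hH).1 hp
  rcases exists_mulVec_eq_or b (blockDiagonal'_isHermitian hB) with ⟨u, hu⟩ | ⟨z, hz, hbz⟩
  · left
    obtain ⟨j⟩ := ‹Nonempty ι›
    have hui : ∀ i, B i *ᵥ (fun x => u ⟨i, x⟩) = -fun x => b ⟨i, x⟩ := fun i => by
      funext x
      have := congrFun hu ⟨i, x⟩
      rw [Matrix.mulVec, dotProduct, Fintype.sum_sigma,
        Finset.sum_eq_single_of_mem i (Finset.mem_univ i)] at this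
      · simpa [Matrix.blockDiagonal'_apply_eq, Matrix.mulVec, dotProduct] using this
      · intro k _ hk
        simp [Matrix.blockDiagonal'_apply_ne _ _ _ hk.symm]
    -- For `i ≠ j` the corner cancels the square left after completing the square, so `(1, u_i)`
    -- lies in the radical of the `i`-th form. Summand `j` takes the rest of `a`.
    let α : ι → ℝ := Function.update (fun i => quadOf (B i) fun x => u ⟨i, x⟩) j
      (a - ∑ i ∈ Finset.univ.erase j, quadOf (B i) fun x => u ⟨i, x⟩)
    have hα : ∀ i, i ≠ j → α i = quadOf (B i) fun x => u ⟨i, x⟩ := fun i hi => by simp [α, hi]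
    have hsum : ∑ i, α i = a := by
      rw [← Finset.add_sum_erase _ _ (Finset.mem_univ j),
        Finset.sum_congr rfl fun i hi => hα i (Finset.ne_of_mem_erase hi)]
      simp [α]
    choose q hq hqin using fun i => exists_mem_of_borderForm (Equiv.optionSubtypeNe (w i)) (α i)
      (fun x => b ⟨i, x⟩) (hB i) (G := G i) (fun x => by rw [hb]; simp)
      (hasGraph_comap_optionSubtypeNe.2 (hBG i))
    have hprod := IsInertia.pi hqin fun i => borderForm_zero _ _ _
    -- Both maps preserve the forms: for `i ≠ j`, gluing moves the `i`-th component only along the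
    -- radical vector `(1, u_i)`, and restriction is the splitting of the bordered form.
    refine ⟨q, hq, hprod.eq_of_maps hin (glueSummands j u) (fun y => ?_) (restrictSummands 𝕜 _)
      fun x => ?_⟩
    · rw [← hsum, borderForm_blockDiagonal']
      refine Finset.sum_congr rfl fun i _ => ?_
      by_cases hij : i = j
      · subst hij
        simp [glueSummands]
      · rw [borderForm_of_mulVec_eq (hB i) (hui i), borderForm_of_mulVec_eq (hB i) (hui i),
          hα i hij, sub_self, zero_mul, zero_mul, add_zero, add_zero]
        congr 1
        funext x
        simp only [glueSummands, LinearMap.coe_mk, AddHom.coe_mk, Pi.add_apply, Pi.smul_apply,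
          smul_eq_mul]
        ring
    · rw [← hsum, borderForm_blockDiagonal']
      rfl
  · right
    exact ⟨fun i => partialInertia (hB i), fun i => ⟨B i, hB i, hBG i, rfl⟩,
      (hin.borderForm_eq (isInertia_quadOf_blockDiagonal' fun i => isInertia_partialInertia (hB i))
        (blockDiagonal'_isHermitian hB) hz hbz).symm⟩

/-- The inertia set of a vertex sum, over the real or the complex numbers. -/
theorem inertiaSetOver_eq_of_isVertexSum [Nonempty ι] (hH : IsVertexSum H v G w) :
    inertiaSetOver 𝕜 H =
      truncateAt (Fintype.card W) (∑ i, inertiaSetOver 𝕜 (G i)) ∪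
        truncateAt (Fintype.card W)
          ((∑ i, inertiaSetOver 𝕜 (deleteVertex (G i) (w i))) + {((1 : ℕ), (1 : ℕ))}) := by
  ext p
  simp only [truncateAt, Set.mem_union, Set.mem_ofPred_eq, Set.mem_fintype_sum, Set.add_singleton,
    Set.mem_image, exists_prop]
  constructor
  · intro hp
    have hn : p.1 + p.2 ≤ Fintype.card W := by
      obtain ⟨A, hA, -, rfl⟩ := hp
      exact partialInertia_add_le hA
    rcases exists_sum_eq_of_mem_inertiaSetOver hH hp with h | ⟨q, hq, h⟩
    · exact Or.inl ⟨h, hn⟩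
    · exact Or.inr ⟨⟨_, ⟨q, hq, rfl⟩, h⟩, hn⟩
  · rintro (⟨⟨q, hq, rfl⟩, hn⟩ | ⟨⟨_, ⟨q, hq, rfl⟩, rfl⟩, hn⟩)
    · exact sum_mem_inertiaSetOver hH hq hn
    · exact sum_add_mem_inertiaSetOver hH hq hn

end InertiaFormula

theorem theorem4p4 {W : Type*} [Fintype W] [DecidableEq W] (G : SimpleGraph W) (v : W)
    (k : ℕ) (hk : 2 ≤ k)
    {V : Fin k → Type*} [∀ i, Fintype (V i)] [∀ i, DecidableEq (V i)]
    (Gs : ∀ i, SimpleGraph (V i)) (vs : ∀ i, V i)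
    (hV : ∀ i, 2 ≤ Fintype.card (V i))
    (hG : IsVertexSum G v Gs vs) :
    inertiaSet G =
        truncateAt (Fintype.card W) (∑ i, inertiaSet (Gs i)) ∪
          truncateAt (Fintype.card W)
            ((∑ i, inertiaSet (deleteVertex (Gs i) (vs i))) + {((1 : ℕ), (1 : ℕ))}) ∧
      hermitianInertiaSet G =
        truncateAt (Fintype.card W) (∑ i, hermitianInertiaSet (Gs i)) ∪
          truncateAt (Fintype.card W)
            ((∑ i, hermitianInertiaSet (deleteVertex (Gs i) (vs i))) + {((1 : ℕ), (1 : ℕ))}) := by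
  have : Nonempty (Fin k) := ⟨⟨0, by omega⟩⟩
  exact ⟨inertiaSetOver_eq_of_isVertexSum hG, inertiaSetOver_eq_of_isVertexSum hG⟩
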